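/- **Conventions.** A bigraph $B=(X,Y,E)$ is a bipartite graph with given partite sets $X,Y$. Let $\mathcal U$ be the family of all real intervals of length $1$, of any of the four types $[a,a+1]$, $(a,a+1)$, $[a,a+1)$, $(a,a+1]$. A $\mathcal U$-representation of $B$ is a map $I:X\cup Y\to\mathcal U$ such that distinct vertices $p,q$ are adjacent if and only if $I(p)\cap I(q)\neq\emptyset$ and $p,q$ lie in different partite sets; $B$ is a mixed unit interval bigraph ($\mathcal U$-bigraph) if it has a $\mathcal U$-representation. A $\mathcal U$-representation $J$ of $B$ arises from a $\mathcal U$-representation $I$ by *trivial modifications* if it is obtained from $I$ by finitely many steps, each of which yields again a $\mathcal U$-representation of $B$ and is one of: shifting one interval; changing the type of one interval (same endpoints); reflecting the entire model about a point; translating the entire model; relabeling the intervals by an automorphism of $B$ that preserves the partite sets. Let $i\ge 1$. The bigraph $S'_i$ has the vertices $x_0,y_0,x',y',x_1''$, $s_0,\dots,s_{i+1}$ and $t_1,\dots,t_{i+1}$, and the edges $x_0y_0$, $y_0s_0$, $x'y'$, $y's_0$, $x_1''s_1$, $x_1''t_1$, and $s_js_{j+1}$, $s_jt_{j+1}$ for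 $0\le j\le i$. Here $x=s_0$, $y_n=s_{2n-1}$, $x_n=s_{2n}$, $y_n'=t_{2n-1}$, $x_n'=t_{2n}$ ($n\ge1$), $u=s_i$, $v'=s_{i+1}$, $v''=t_{i+1}$; vertices named $x$ (with any index or primes) are in $X$, those named $y$ in $Y$. The bigraph $S_i$ arises from $S'_i$ by attaching one new pendant vertex to $v'$ and another one to $v''$. The bipartite claw $H_1$ is the tree obtained from $K_{1,3}$ by subdividing every edge once. **Lemma 9.** Let $i\ge 1$. (a) The vertices $x_0,y_0,x,y',x',y_1,x_1$ induce $H_1$ in $S'_i$. The map $I$ given by $$I(x)=[0,1],\quad I(x')=I(y')=(0,1),\quad I(y_0)=[-1,0],\quad I(x_0)=[-2,-1]\text{ or }(-2,-1],\quad I(x_1'')=(1,2),$$ $$I(y_n)=[2n-1,2n],\quad I(x_n)=[2n,2n+1],\quad I(y_n')=[2n-1,2n),\quad I(x_n')=[2n,2n+1)\qquad(n\ge 1)$$ (so that $I(u)=[i,i+1]$, $I(v')=[i+1,i+2]$, $I(v'')=[i+1,i+2)$) is, for either choice of $I(x_0)$, a $\mathcal U$-representation of $S'_i$, and it is unique up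 to trivial modifications: every $\mathcal U$-representation of $S'_i$ arises from it by trivial modifications. (b) $S_i$ is a forbidden induced subgraph of $\mathcal U$-bigraphs: no mixed unit interval bigraph contains $S_i$ as an induced subgraph. -/

import Mathlib

/-- A bipartite graph `B = (X, Y, E)` on the vertex set `V = X ∪ Y`: a simple graph together with a
partition of its vertices into two partite sets (`X` is where `side` is `true`), every edge
joining vertices of different partite sets. -/
structure Bigraph (V : Type*) where
  graph : SimpleGraph V
  side : V → Bool
  side_ne : ∀ u v, graph.Adj u v → side u ≠ side v

/-- The four unit intervals with left endpoint `a`: closed, open, closed-open, open-closed. -/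
def unitIntervalsAt (a : ℝ) : Set (Set ℝ) :=
  {Set.Icc a (a + 1), Set.Ioo a (a + 1), Set.Ico a (a + 1), Set.Ioc a (a + 1)}

/-- The family `𝒰` of all unit intervals of the real line, of all four types. -/
def mixedUnitIntervals : Set (Set ℝ) := {I | ∃ a : ℝ, I ∈ unitIntervalsAt a}

/-- `f` is an `M`-intersection representation of the bigraph `B`. -/
def IsIntersectionRep {V : Type*} (M : Set (Set ℝ)) (B : Bigraph V) (f : V → Set ℝ) : Prop :=
  (∀ v, f v ∈ M) ∧
  ∀ u v, u ≠ v → (B.graph.Adj u v ↔ (f u ∩ f v).Nonempty ∧ B.side u ≠ B.side v)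

/-- `f` is a mixed unit interval representation (a `𝒰`-intersection representation) of `B`. -/
def IsMixedUnitRep {V : Type*} (B : Bigraph V) (f : V → Set ℝ) : Prop :=
  IsIntersectionRep mixedUnitIntervals B f

/-- `B` is a mixed unit interval bigraph (a `𝒰`-bigraph). -/
def IsMixedUnitIntervalBigraph {V : Type*} (B : Bigraph V) : Prop :=
  ∃ f : V → Set ℝ, IsMixedUnitRep B f

open Classical in
/-- The elementary changes of a family of intervals indexed by the vertices of `B`. -/
inductive ElementaryChange {V : Type*} (B : Bigraph V) : (V → Set ℝ) → (V → Set ℝ) → Prop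
  /-- shift a single interval -/
  | shift (f : V → Set ℝ) (v : V) (c : ℝ) :
      ElementaryChange B f (Function.update f v ((fun r => r + c) '' f v))
  /-- change the type of a single interval, keeping its endpoints -/
  | retype (f : V → Set ℝ) (v : V) (a : ℝ) (J : Set ℝ)
      (hf : f v ∈ unitIntervalsAt a) (hJ : J ∈ unitIntervalsAt a) :
      ElementaryChange B f (Function.update f v J)
  /-- reflect the entire model about the point `p` -/
  | reflect (f : V → Set ℝ) (p : ℝ) :
      ElementaryChange B f (fun v => (fun r => 2 * p - r) '' f v)
  /-- translate the entire model -/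
  | translate (f : V → Set ℝ) (c : ℝ) :
      ElementaryChange B f (fun v => (fun r => r + c) '' f v)
  /-- relabel the intervals by an automorphism of the bigraph -/
  | relabel (f : V → Set ℝ) (σ : B.graph ≃g B.graph) (hσ : ∀ v, B.side (σ v) = B.side v) :
      ElementaryChange B f (fun v => f (σ v))

/-- An elementary change between two mixed unit interval representations of `B`: it has to
preserve all intersections and non-intersections of intervals of different partite sets. -/
def ElementaryModification {V : Type*} (B : Bigraph V) (f g : V → Set ℝ) : Prop :=
  IsMixedUnitRep B f ∧ IsMixedUnitRep B g ∧ ElementaryChange B f g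

/-- `g` arises from `f` by trivial modifications: by finitely many elementary changes, with a
mixed unit interval representation of `B` at every stage. -/
def TrivialModification {V : Type*} (B : Bigraph V) (f g : V → Set ℝ) : Prop :=
  Relation.ReflTransGen (ElementaryModification B) f g

/-- The bipartite claw `H₁`: the center `none` and three legs `none - (k, false) - (k, true)`. -/
def bipartiteClaw : SimpleGraph (Option (Fin 3 × Bool)) :=
  SimpleGraph.fromRel fun a b =>
    match a, b with
    | none, some (_, false) => True
    | some (k, false), some (l, true) => k = l
    | _, _ => False

/-- The vertices of `S'ᵢ`. Here `x0`, `y0`, `xPrime`, `yPrime`, `xOne''` are the vertices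
`x₀`, `y₀`, `x'`, `y'`, `x₁''`. The path `x, y₁, x₁, y₂, x₂, …, u, v'` is
`s 0, s 1, …, s (i + 1)`, so that `s 0 = x`, `s (2n - 1) = yₙ`, `s (2n) = xₙ`, `s i = u`,
`s (i + 1) = v'`. The vertices `y₁', x₁', y₂', x₂', …, v''` are `t 0, t 1, …, t i`, so that
`t (2n - 2) = yₙ'`, `t (2n - 1) = xₙ'`, `t i = v''`. -/
inductive SPrimeVertex (i : ℕ) : Type
  | x0 : SPrimeVertex i
  | y0 : SPrimeVertex i
  | xPrime : SPrimeVertex i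
  | yPrime : SPrimeVertex i
  | xOne'' : SPrimeVertex i
  | s (j : Fin (i + 2)) : SPrimeVertex i
  | t (k : Fin (i + 1)) : SPrimeVertex i

/-- The edges of `S'ᵢ`, each listed in one orientation. -/
def sPrimeEdge (i : ℕ) : SPrimeVertex i → SPrimeVertex i → Prop
  | .x0, .y0 => True
  | .y0, .s j => (j : ℕ) = 0
  | .xPrime, .yPrime => True
  | .yPrime, .s j => (j : ℕ) = 0
  | .xOne'', .s j => (j : ℕ) = 1
  | .xOne'', .t k => (k : ℕ) = 0
  | .s j, .s k => (k : ℕ) = j + 1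
  | .s j, .t k => (k : ℕ) = j
  | _, _ => False

/-- The partite set `X` of `S'ᵢ`. -/
def sPrimeSide (i : ℕ) : SPrimeVertex i → Bool
  | .x0 => true
  | .y0 => false
  | .xPrime => true
  | .yPrime => false
  | .xOne'' => true
  | .s j => decide ((j : ℕ) % 2 = 0)
  | .t k => decide ((k : ℕ) % 2 = 1)

theorem sPrimeSide_ne (i : ℕ) (u v : SPrimeVertex i) (h : sPrimeEdge i u v) :
    sPrimeSide i u ≠ sPrimeSide i v := by
  cases u <;> cases v <;> simp only [sPrimeEdge] at h <;> simp [sPrimeSide] <;> omega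

/-- The bigraph `S'ᵢ`. -/
def SPrime (i : ℕ) : Bigraph (SPrimeVertex i) where
  graph := SimpleGraph.fromRel (sPrimeEdge i)
  side := sPrimeSide i
  side_ne := by
    rintro u v ⟨-, h | h⟩
    · exact sPrimeSide_ne i u v h
    · exact (sPrimeSide_ne i v u h).symm

/-- The edges of `Sᵢ`, each listed in one orientation: those of `S'ᵢ`, and those that join `v'`
and `v''` to a new pendant vertex each (`inr false` and `inr true`). -/
def sEdge (i : ℕ) : SPrimeVertex i ⊕ Bool → SPrimeVertex i ⊕ Bool → Prop
  | .inl a, .inl b => sPrimeEdge i a b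
  | .inl a, .inr false => a = .s (Fin.last (i + 1))
  | .inl a, .inr true => a = .t (Fin.last i)
  | _, _ => False

/-- The partite set `X` of `Sᵢ`. -/
def sSide (i : ℕ) : SPrimeVertex i ⊕ Bool → Bool
  | .inl a => sPrimeSide i a
  | .inr _ => decide (i % 2 = 0)

theorem sSide_ne (i : ℕ) (u v : SPrimeVertex i ⊕ Bool) (h : sEdge i u v) :
    sSide i u ≠ sSide i v := by
  rcases u with a | a | a <;> rcases v with b | b | b <;> simp only [sEdge] at h
  · exact sPrimeSide_ne i a b h
  · subst h; simp [sSide, sPrimeSide]; omega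
  · subst h; simp [sSide, sPrimeSide]; omega

/-- The bigraph `Sᵢ`. -/
def SBigraph (i : ℕ) : Bigraph (SPrimeVertex i ⊕ Bool) where
  graph := SimpleGraph.fromRel (sEdge i)
  side := sSide i
  side_ne := by
    rintro u v ⟨-, h | h⟩
    · exact sSide_ne i u v h
    · exact (sSide_ne i v u h).symm

/-- The standard representation of `S'ᵢ`, in which the interval of `x₀` is `X₀`. -/
def sPrimeRep (i : ℕ) (X₀ : Set ℝ) : SPrimeVertex i → Set ℝ
  | .x0 => X₀
  | .y0 => Set.Icc (-1) 0
  | .xPrime => Set.Ioo 0 1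
  | .yPrime => Set.Ioo 0 1
  | .xOne'' => Set.Ioo 1 2
  | .s j => Set.Icc ((j : ℕ) : ℝ) (((j : ℕ) : ℝ) + 1)
  | .t k => Set.Ico (((k : ℕ) : ℝ) + 1) (((k : ℕ) : ℝ) + 2)

/-! Two unit intervals with the same endpoints are told apart only by an interval touching an
endpoint that one contains and the other omits. If each has a private neighbour, these lie on
opposite sides, and each of the two contains exactly the endpoint that the other omits
(`privates_of_left_eq`). Hence, if `x` meets three intervals with private neighbours, the available
room of two units forces everything: the outer two touch `x` at its endpoints, and the private
neighbour of the middle one is the open interior of `x` (`claw_middle`).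

In the claw at `x`, the interval y₁ cannot be the middle one: x₁' and x₁'' would both be the
interior of `x`, although y₁' meets only x₁'' (`legs`). Up to reflection y₁ is on the right,
together with y₁'. From there each pair `s (j + 1)`, `t j` has equal endpoints and a common left
end, and the next pair meets only `s (j + 1)`, so it is pushed one unit to the right (`chain`). Thus
v' and v'' have the same endpoints and share one of them, which leaves no room for two private
pendant neighbours (`no_private_pair`). This excludes Sᵢ.

For uniqueness, reflection, exchange of two legs and translation give x = [0, 1] with y₀ on the
left. What remains free is the intervals of x₀, y', x₁'' and three endpoint inclusions, subject to
explicit inequalities (`SPrimeConfig.Valid`); single moves connect every solution to the standard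
one. Since trivial modifications are reversible, this suffices. -/

/-! ### Unit intervals as endpoint data -/

/-- A unit interval, given by its left endpoint and by which of its endpoints it contains. -/
structure UnitData where
  a : ℝ
  l : Prop
  r : Prop

namespace UnitData

/-- The set of points of a unit interval. -/
def toSet (p : UnitData) : Set ℝ :=
  {x | (p.a < x ∧ x < p.a + 1) ∨ (p.l ∧ x = p.a) ∨ (p.r ∧ x = p.a + 1)}

/-- The mirror image under `x ↦ 1 - x`. -/
def reflect (p : UnitData) : UnitData := ⟨-p.a, p.r, p.l⟩

/-- The endpoint criterion for two unit intervals to intersect. -/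
def Meet (p q : UnitData) : Prop :=
  (p.a < q.a + 1 ∧ q.a < p.a + 1) ∨ (q.a = p.a + 1 ∧ p.r ∧ q.l) ∨ (p.a = q.a + 1 ∧ q.r ∧ p.l)

theorem inter_nonempty_iff (p q : UnitData) : (p.toSet ∩ q.toSet).Nonempty ↔ Meet p q := by
  constructor
  · rintro ⟨x, h1, h2⟩
    simp only [toSet, Set.mem_ofPred_eq] at h1 h2
    unfold Meet
    rcases h1 with ⟨_, _⟩ | ⟨_, h⟩ | ⟨_, h⟩ <;> rcases h2 with ⟨_, _⟩ | ⟨_, h'⟩ | ⟨_, h'⟩ <;>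
      first
      | (left; constructor <;> linarith)
      | (right; left; exact ⟨by linarith, by assumption, by assumption⟩)
      | (right; right; exact ⟨by linarith, by assumption, by assumption⟩)
  · rintro (⟨h1, h2⟩ | ⟨h, hr, hl⟩ | ⟨h, hr, hl⟩)
    · exact ⟨(p.a + q.a + 1) / 2, Or.inl ⟨by linarith, by linarith⟩,
        Or.inl ⟨by linarith, by linarith⟩⟩
    · exact ⟨q.a, Or.inr (Or.inr ⟨hr, h⟩), Or.inr (Or.inl ⟨hl, rfl⟩)⟩
    · exact ⟨p.a, Or.inr (Or.inl ⟨hl, rfl⟩), Or.inr (Or.inr ⟨hr, h⟩)⟩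

theorem Meet.symm {p q : UnitData} (h : Meet p q) : Meet q p := by
  unfold Meet at *; tauto

theorem meet_reflect (p q : UnitData) : Meet p.reflect q.reflect ↔ Meet p q := by
  have e1 : (-p.a < -q.a + 1 ∧ -q.a < -p.a + 1) ↔ (p.a < q.a + 1 ∧ q.a < p.a + 1) := by
    constructor <;> rintro ⟨_, _⟩ <;> constructor <;> linarith
  have e2 : (-q.a = -p.a + 1) ↔ p.a = q.a + 1 := by constructor <;> intro _ <;> linarith
  have e3 : (-p.a = -q.a + 1) ↔ q.a = p.a + 1 := by constructor <;> intro _ <;> linarith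
  unfold Meet reflect
  rw [e1, e2, e3]
  tauto

theorem toSet_Icc (a : ℝ) : toSet ⟨a, True, True⟩ = Set.Icc a (a + 1) := by
  ext x
  simp only [toSet, true_and, Set.mem_ofPred_eq, Set.mem_Icc]
  constructor
  · rintro (⟨_, _⟩ | h | h) <;> constructor <;> linarith
  · rintro ⟨h1, h2⟩
    rcases h1.eq_or_lt with h | h
    · exact Or.inr (Or.inl h.symm)
    rcases h2.eq_or_lt with h' | h'
    · exact Or.inr (Or.inr h')
    exact Or.inl ⟨h, h'⟩

theorem toSet_Ioo (a : ℝ) : toSet ⟨a, False, False⟩ = Set.Ioo a (a + 1) := by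
  ext x
  simp [toSet]

theorem toSet_Ico (a : ℝ) : toSet ⟨a, True, False⟩ = Set.Ico a (a + 1) := by
  ext x
  simp only [toSet, true_and, false_and, or_false, Set.mem_ofPred_eq, Set.mem_Ico]
  constructor
  · rintro (⟨_, _⟩ | h) <;> constructor <;> linarith
  · rintro ⟨h1, h2⟩
    rcases h1.eq_or_lt with h | h
    · exact Or.inr h.symm
    exact Or.inl ⟨h, h2⟩

theorem toSet_Ioc (a : ℝ) : toSet ⟨a, False, True⟩ = Set.Ioc a (a + 1) := by
  ext x
  simp only [toSet, true_and, false_and, false_or, Set.mem_ofPred_eq, Set.mem_Ioc]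
  constructor
  · rintro (⟨_, _⟩ | h) <;> constructor <;> linarith
  · rintro ⟨h1, h2⟩
    rcases h2.eq_or_lt with h | h
    · exact Or.inr h
    exact Or.inl ⟨h1, h⟩

theorem toSet_mem (p : UnitData) : p.toSet ∈ unitIntervalsAt p.a := by
  obtain ⟨a, l, r⟩ := p
  by_cases hl : l <;> by_cases hr : r <;>
    simp only [hl, hr, unitIntervalsAt, toSet_Icc, toSet_Ioo, toSet_Ico, toSet_Ioc,
      Set.mem_insert_iff, Set.mem_singleton_iff, true_or, or_true]

theorem toSet_mem_mixed (p : UnitData) : p.toSet ∈ mixedUnitIntervals := ⟨p.a, p.toSet_mem⟩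

theorem exists_toSet {S : Set ℝ} (h : S ∈ mixedUnitIntervals) : ∃ p : UnitData, S = p.toSet := by
  obtain ⟨a, h⟩ := h
  rcases h with h | h | h | h
  · exact ⟨_, h.trans (toSet_Icc a).symm⟩
  · exact ⟨_, h.trans (toSet_Ioo a).symm⟩
  · exact ⟨_, h.trans (toSet_Ico a).symm⟩
  · exact ⟨_, h.trans (toSet_Ioc a).symm⟩

theorem image_add (p : UnitData) (c : ℝ) :
    (fun x => x + c) '' p.toSet = toSet ⟨p.a + c, p.l, p.r⟩ := by
  ext x
  simp only [Set.mem_image, toSet, Set.mem_ofPred_eq]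
  constructor
  · rintro ⟨y, ⟨_, _⟩ | ⟨h, rfl⟩ | ⟨h, rfl⟩, rfl⟩
    · left; constructor <;> linarith
    · exact Or.inr (Or.inl ⟨h, rfl⟩)
    · exact Or.inr (Or.inr ⟨h, by ring⟩)
  · intro h
    refine ⟨x - c, ?_, by ring⟩
    rcases h with ⟨_, _⟩ | ⟨h, rfl⟩ | ⟨h, rfl⟩
    · left; constructor <;> linarith
    · exact Or.inr (Or.inl ⟨h, by ring⟩)
    · exact Or.inr (Or.inr ⟨h, by ring⟩)

theorem image_reflect (p : UnitData) (c : ℝ) :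
    (fun x => 2 * c - x) '' p.toSet = toSet ⟨2 * c - p.a - 1, p.r, p.l⟩ := by
  ext x
  simp only [Set.mem_image, toSet, Set.mem_ofPred_eq]
  constructor
  · rintro ⟨y, ⟨_, _⟩ | ⟨h, rfl⟩ | ⟨h, rfl⟩, rfl⟩
    · left; constructor <;> linarith
    · exact Or.inr (Or.inr ⟨h, by ring⟩)
    · exact Or.inr (Or.inl ⟨h, by ring⟩)
  · intro h
    refine ⟨2 * c - x, ?_, by ring⟩
    rcases h with ⟨_, _⟩ | ⟨h, rfl⟩ | ⟨h, rfl⟩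
    · left; constructor <;> linarith
    · exact Or.inr (Or.inr ⟨h, by ring⟩)
    · exact Or.inr (Or.inl ⟨h, by ring⟩)

/-! ### Private neighbours and the claw -/

/-- Two unit intervals with the same left endpoint can have private neighbours only on opposite
sides. -/
theorem privates_of_left_eq {a b c d : UnitData} (e : a.a = b.a) (h1 : Meet c a) (h2 : ¬ Meet c b)
    (h3 : Meet d b)
    (h4 : ¬ Meet d a) :
      c.a = a.a + 1 ∧ d.a = a.a - 1 ∧ a.r ∧ ¬ b.r  ∧ b.l ∧ ¬ a.l ∨
      c.a = a.a - 1 ∧ d.a = a.a + 1 ∧ a.l ∧ ¬ b.l  ∧ b.r ∧ ¬ a.r := by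
  obtain ⟨x, xl, xr⟩ := a
  obtain ⟨p, pl, pr⟩ := b
  obtain ⟨q, ql, qr⟩ := c
  obtain ⟨r, rl, rr⟩ := d
  simp only [Meet] at *
  subst e
  -- Overlap of interiors depends only on left endpoints, so it would make `c` meet `b`, or `d` meet
  -- `a`. Only touching remains.
  have h5 : ¬ (q < x + 1 ∧ x < q + 1) := by tauto
  have h6 : ¬ (r < x + 1 ∧ x < r + 1) := by tauto
  simp only [h5, h6, false_or] at h1 h2 h3 h4
  rcases h1 with ⟨rfl, h1⟩ | ⟨rfl, h1⟩ <;> rcases h3 with ⟨h3, h3'⟩ | ⟨rfl, h3'⟩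
  · obtain rfl : q = r := by linarith
    simp at *
    tauto
  · right
    simp at *
    tauto
  · subst h3
    left
    simp at *
    tauto
  · simp at *
    tauto

theorem far_of_not_meet {a b : UnitData} (h : ¬ Meet a b) : a.a + 1 ≤ b.a ∨ b.a + 1 ≤ a.a := by
  by_contra! h'
  exact h (Or.inl ⟨h'.2, h'.1⟩)

theorem Meet.near {a b : UnitData} (h : Meet a b) : a.a ≤ b.a + 1 ∧ b.a ≤ a.a + 1 := by
  rcases h with h | h | h <;> constructor <;> linarith

theorem meet_iff_touch {a b : UnitData} (h : b.a = a.a + 1) : Meet a b ↔ a.r ∧ b.l := by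
  simp [Meet, h]
  intro h
  linarith

/-- Otherwise `q` and `r` have the same endpoints, with `Q` touching on the right and `R` on the
left, and `q` omits its left end. As `R` misses `p`, either `p` has these endpoints too, and three
private neighbours would need pairwise opposite sides, or `p` is two units further left, and `x` can
reach `q` only at the end that `q` omits. -/
theorem claw_middle_lt {x p q r P Q R : UnitData}
    (hxp : Meet x p) (hxq : Meet x q) (hxr : Meet x r)
    (hPp : Meet P p) (hQq : Meet Q q) (hRr : Meet R r)
    (nPq : ¬ Meet P q) (nPr : ¬ Meet P r) (nQp : ¬ Meet Q p) (nQr : ¬ Meet Q r)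
    (nRp : ¬ Meet R p) (nRq : ¬ Meet R q) (h1 : p.a ≤ q.a) (h2 : q.a ≤ r.a) : Q.a < r.a + 1 := by
  by_contra! h
  have hQq' := Meet.near hQq
  have e : q.a = r.a := by linarith
  have hxp' := Meet.near hxp
  have hxr' := Meet.near hxr
  have hR := far_of_not_meet nRp
  rcases privates_of_left_eq e hQq nQr hRr nRq with h' | h'
  · rcases hR with hR | hR
    · have e2 : p.a = q.a := by linarith
      have f1 := privates_of_left_eq e2 hPp nPq hQq nQp
      have f2 := privates_of_left_eq (e2.trans e) hPp nPr hRr nRp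
      grind -ring
    · rw [meet_iff_touch (by linarith)] at hxq
      tauto
  · linarith

/-- If `x` meets three unit intervals each of which has a private neighbour, then the outer two of
them touch `x` at its endpoints, and the private neighbour of the middle one is the interior
of `x`. -/
theorem claw_middle {x p q r P Q R : UnitData} (hxp : Meet x p) (hxq : Meet x q) (hxr : Meet x r)
    (hPp : Meet P p) (hQq : Meet Q q) (hRr : Meet R r)
    (nPq : ¬ Meet P q) (nPr : ¬ Meet P r) (nQp : ¬ Meet Q p) (nQr : ¬ Meet Q r)
    (nRp : ¬ Meet R p) (nRq : ¬ Meet R q) (h1 : p.a ≤ q.a) (h2 : q.a ≤ r.a) :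
    p.a = x.a - 1 ∧ r.a = x.a + 1 ∧ x.l ∧ x.r ∧ p.r ∧ r.l ∧ Q.a = x.a ∧ ¬ Q.l ∧ ¬ Q.r ∧
      x.a - 1 < q.a ∧ q.a < x.a + 1 := by
  have k1 := claw_middle_lt hxp hxq hxr hPp hQq hRr nPq nPr nQp nQr nRp nRq h1 h2
  have k2 := claw_middle_lt (x := x.reflect) (p := r.reflect) (q := q.reflect) (r := p.reflect)
    (P := R.reflect) (Q := Q.reflect) (R := P.reflect)
    (by rwa [meet_reflect]) (by rwa [meet_reflect]) (by rwa [meet_reflect]) (by rwa [meet_reflect])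
    (by rwa [meet_reflect]) (by rwa [meet_reflect]) (by rwa [meet_reflect]) (by rwa [meet_reflect])
    (by rwa [meet_reflect]) (by rwa [meet_reflect]) (by rwa [meet_reflect]) (by rwa [meet_reflect])
    (neg_le_neg h2) (neg_le_neg h1)
  simp only [reflect] at k2
  have hxp' := Meet.near hxp
  have hxr' := Meet.near hxr
  -- `Q` misses `p` and `r` and lies beyond neither, so `p.a + 2 ≤ Q.a + 1 ≤ r.a`. Both outer
  -- intervals meet `x`, so `r.a ≤ p.a + 2`, and equality holds throughout.
  have hr : r.a = Q.a + 1 := by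
    rcases far_of_not_meet nQr with h | h <;> rcases far_of_not_meet nQp with h' | h' <;> linarith
  have hp : Q.a = p.a + 1 := by
    rcases far_of_not_meet nQr with h | h <;> rcases far_of_not_meet nQp with h' | h' <;> linarith
  have hx : Q.a = x.a := by linarith
  rw [meet_iff_touch (by linarith)] at hxr
  replace hxp := hxp.symm
  rw [meet_iff_touch (by linarith)] at hxp
  rw [meet_iff_touch hr] at nQr
  replace nQp := fun h : Meet p Q => nQp h.symm
  rw [meet_iff_touch hp] at nQp
  have hl : ¬ Q.l := by tauto
  have hr' : ¬ Q.r := by tauto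
  refine ⟨by linarith, by linarith, hxp.2, hxr.1, hxp.1, hxr.2, hx, hl, hr', ?_⟩
  rcases hQq with h | h | h
  · constructor <;> linarith
  · tauto
  · tauto
/-- Two unit intervals with the same left endpoint, which they both contain, are distinguished only
by intervals that touch one of them on the right. -/
theorem right_of_private {p q z : UnitData} (ha : p.a = q.a) (hp : p.l) (hq : q.l)
    (h : Meet p z) (hn : ¬ Meet q z) : p.r ∧ ¬ q.r ∧ z.a = p.a + 1 ∧ z.l := by
  obtain ⟨p, pl, pr⟩ := p
  obtain ⟨q, ql, qr⟩ := q
  obtain ⟨z, zl, zr⟩ := z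
  simp only [Meet] at *
  grind

end UnitData

/-! ### Representations and reversibility of trivial modifications -/

theorem isMixedUnitRep_toSet_iff {V : Type*} (B : Bigraph V) (D : V → UnitData) :
    IsMixedUnitRep B (fun v => (D v).toSet) ↔
      ∀ u v, B.side u ≠ B.side v → (B.graph.Adj u v ↔ (D u).Meet (D v)) := by
  constructor
  · intro h u v huv
    rw [h.2 u v (fun e => huv (e ▸ rfl)), UnitData.inter_nonempty_iff]
    exact and_iff_left huv
  · refine fun h => ⟨fun v => (D v).toSet_mem_mixed, fun u v _ => ?_⟩
    rw [UnitData.inter_nonempty_iff]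
    by_cases huv : B.side u = B.side v
    · exact ⟨fun e => absurd huv (B.side_ne u v e), fun e => absurd huv e.2⟩
    · rw [h u v huv]
      exact (and_iff_left huv).symm

theorem IsMixedUnitRep.exists_unitData {V : Type*} {B : Bigraph V} {f : V → Set ℝ}
    (h : IsMixedUnitRep B f) : ∃ D : V → UnitData, f = fun v => (D v).toSet := by
  choose D hD using fun v => UnitData.exists_toSet (h.1 v)
  exact ⟨D, funext hD⟩

theorem IsMixedUnitRep.translate {V : Type*} {B : Bigraph V} {f : V → Set ℝ}
    (h : IsMixedUnitRep B f) (c : ℝ) : IsMixedUnitRep B (fun v => (fun x => x + c) '' f v) := by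
  refine ⟨fun v => ?_, fun u v huv => ?_⟩
  · obtain ⟨p, hp⟩ := UnitData.exists_toSet (h.1 v)
    simp only [hp, UnitData.image_add]
    exact UnitData.toSet_mem_mixed _
  · rw [h.2 u v huv, ← Set.image_inter (add_left_injective c), Set.image_nonempty]

theorem IsMixedUnitRep.reflect {V : Type*} {B : Bigraph V} {f : V → Set ℝ}
    (h : IsMixedUnitRep B f) (c : ℝ) :
    IsMixedUnitRep B (fun v => (fun x => 2 * c - x) '' f v) := by
  refine ⟨fun v => ?_, fun u v huv => ?_⟩
  · obtain ⟨p, hp⟩ := UnitData.exists_toSet (h.1 v)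
    simp only [hp, UnitData.image_reflect]
    exact UnitData.toSet_mem_mixed _
  · rw [h.2 u v huv, ← Set.image_inter (sub_right_injective), Set.image_nonempty]

theorem IsMixedUnitRep.relabel {V : Type*} {B : Bigraph V} {f : V → Set ℝ}
    (h : IsMixedUnitRep B f) (σ : B.graph ≃g B.graph) (hσ : ∀ v, B.side (σ v) = B.side v) :
    IsMixedUnitRep B (fun v => f (σ v)) := by
  refine ⟨fun v => h.1 _, fun u v huv => ?_⟩
  rw [← hσ u, ← hσ v, ← h.2 _ _ (σ.injective.ne huv)]
  exact σ.map_adj_iff.symm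

theorem ElementaryChange.symm {V : Type*} {B : Bigraph V} {f g : V → Set ℝ}
    (h : ElementaryChange B f g) : ElementaryChange B g f := by
  classical
  cases h with
  | shift v c =>
    have h := ElementaryChange.shift (B := B) (Function.update f v ((fun r => r + c) '' f v)) v (-c)
    rw [Function.update_self, Function.update_idem, Set.image_image] at h
    simpa using h
  | retype v a J hf hJ =>
    have h := ElementaryChange.retype (B := B) (Function.update f v J) v a (f v)
      (by rwa [Function.update_self]) hf
    rwa [Function.update_idem, Function.update_eq_self] at h
  | reflect p =>
    have h := ElementaryChange.reflect (B := B) (fun v => (fun r => 2 * p - r) '' f v) p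
    simp only [Set.image_image] at h
    simpa using h
  | translate c =>
    have h := ElementaryChange.translate (B := B) (fun v => (fun r => r + c) '' f v) (-c)
    simp only [Set.image_image] at h
    simpa using h
  | relabel σ hσ =>
    have h := ElementaryChange.relabel (B := B) (fun v => f (σ v)) σ.symm
      (fun v => by rw [← hσ (σ.symm v), RelIso.apply_symm_apply])
    simpa using h

theorem ElementaryModification.symm {V : Type*} {B : Bigraph V} {f g : V → Set ℝ}
    (h : ElementaryModification B f g) : ElementaryModification B g f :=
  ⟨h.2.1, h.1, h.2.2.symm⟩

theorem TrivialModification.symm {V : Type*} {B : Bigraph V} {f g : V → Set ℝ}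
    (h : TrivialModification B f g) : TrivialModification B g f := by
  have : Std.Symm (ElementaryModification B) := ⟨fun _ _ => ElementaryModification.symm⟩
  exact Relation.ReflTransGen.stdSymm.symm _ _ h

/-! ### Rigidity of the representations of S'ᵢ -/

namespace UnitData

/-- A unit interval that meets a translate of `x` by less than a unit, but neither of two unit
intervals that touch `x` at its endpoints, is the interior of `x`. -/
theorem interior_of_not_meet {x L R s z : UnitData} (hL : L.a = x.a - 1) (hR : R.a = x.a + 1)
    (hLr : L.r) (hRl : R.l) (h1 : x.a - 1 < s.a) (h2 : s.a < x.a + 1) (hz : Meet z s)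
    (nL : ¬ Meet z L) (nR : ¬ Meet z R) : z.a = x.a ∧ ¬ z.l ∧ ¬ z.r := by
  have hz' := hz.near
  have e : z.a = x.a := by
    rcases far_of_not_meet nL with h | h <;> rcases far_of_not_meet nR with h' | h' <;> linarith
  rw [meet_iff_touch (by linarith)] at nR
  replace nL := fun h : Meet L z => nL h.symm
  rw [meet_iff_touch (by linarith)] at nL
  tauto

/-- Missing `P`, the interval `t` can only touch `x` at an endpoint. If it were on the left, `z`,
which reaches `s` on the right, would touch `t` at the left end of `x`; but `L` contains that point.
-/
theorem touch_of_common_neighbor {x L s P t z : UnitData} (hL : L.a = x.a - 1) (hLr : L.r)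
    (hs : s.a = x.a + 1) (hP : P.a = x.a) (ht : Meet x t) (hPt : ¬ Meet P t)
    (hzs : Meet z s) (hzt : Meet z t) (hzL : ¬ Meet z L) : t.a = x.a + 1 ∧ t.l := by
  have h1 := ht.near
  have h2 := hzs.near
  have h3 := hzt.near
  rcases far_of_not_meet hPt with h | h
  · have e : t.a = x.a + 1 := by linarith
    rw [meet_iff_touch e] at ht
    exact ⟨e, ht.2⟩
  · replace hzt := hzt.symm
    rw [meet_iff_touch (by linarith)] at hzt
    exact absurd (Meet.symm ((meet_iff_touch (by linarith)).2 ⟨hLr, hzt.2⟩)) hzL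

end UnitData

open UnitData

/-- Interval data with the intersection pattern of `S'ᵢ`. -/
def IsSPrimeData (i : ℕ) (D : SPrimeVertex i → UnitData) : Prop :=
  ∀ u v, sPrimeSide i u ≠ sPrimeSide i v →
    (sPrimeEdge i u v ∨ sPrimeEdge i v u ↔ (D u).Meet (D v))

theorem isMixedUnitRep_sPrime_iff {i : ℕ} (D : SPrimeVertex i → UnitData) :
    IsMixedUnitRep (SPrime i) (fun v => (D v).toSet) ↔ IsSPrimeData i D := by
  rw [isMixedUnitRep_toSet_iff]
  refine forall₃_congr fun u v h => ?_
  have huv : u ≠ v := fun e => h (e ▸ rfl)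
  simp [SPrime, huv]

namespace IsSPrimeData

variable {i : ℕ} {D : SPrimeVertex i → UnitData}

theorem meet (h : IsSPrimeData i D) {u v : SPrimeVertex i} (e : sPrimeEdge i u v) :
    (D u).Meet (D v) :=
  (h u v (sPrimeSide_ne i u v e)).1 (Or.inl e)

theorem not_meet (h : IsSPrimeData i D) {u v : SPrimeVertex i}
    (hs : sPrimeSide i u ≠ sPrimeSide i v) (e : ¬ sPrimeEdge i u v) (e' : ¬ sPrimeEdge i v u) :
    ¬ (D u).Meet (D v) := by
  rw [← h u v hs]
  tauto

theorem reflect (h : IsSPrimeData i D) : IsSPrimeData i (fun v => (D v).reflect) :=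
  fun u v huv => by rw [meet_reflect, h u v huv]

/-- The interval `x` is closed, `y` touches it on the left, `s` and `t` touch it on the right, `m`
lies strictly between them, and `P` is the interior of `x`. -/
structure Legs (x y m P s t : UnitData) : Prop where
  xl : x.l
  xr : x.r
  ya : y.a = x.a - 1
  yr : y.r
  Pa : P.a = x.a
  Pl : ¬ P.l
  Pr : ¬ P.r
  m1 : x.a - 1 < m.a
  m2 : m.a < x.a + 1
  sa : s.a = x.a + 1
  sl : s.l
  ta : t.a = x.a + 1
  tl : t.l

/-- The cases are the orders of the three claw neighbours of `x`. The first alternative is kept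
crude because reflection turns it into one of the others. -/
theorem legs (h : IsSPrimeData i D) (hi : 1 ≤ i) :
    (D (.s ⟨1, by omega⟩)).a = (D (.s 0)).a - 1 ∨
    Legs (D (.s 0)) (D .y0) (D .yPrime) (D .xPrime) (D (.s ⟨1, by omega⟩)) (D (.t 0)) ∨
    Legs (D (.s 0)) (D .yPrime) (D .y0) (D .x0) (D (.s ⟨1, by omega⟩)) (D (.t 0)) := by
  have a1 : Meet (D (.s 0)) (D .y0) := (h.meet (by simp [sPrimeEdge])).symm
  have a2 : Meet (D (.s 0)) (D .yPrime) := (h.meet (by simp [sPrimeEdge])).symm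
  have a3 : Meet (D (.s 0)) (D (.s ⟨1, by omega⟩)) := h.meet (by simp [sPrimeEdge])
  have b1 : Meet (D .x0) (D .y0) := h.meet (by simp [sPrimeEdge])
  have b2 : Meet (D .xPrime) (D .yPrime) := h.meet (by simp [sPrimeEdge])
  have b3 : Meet (D (.s ⟨2, by omega⟩)) (D (.s ⟨1, by omega⟩)) :=
    (h.meet (by simp [sPrimeEdge])).symm
  have n12 : ¬ Meet (D .x0) (D .yPrime) :=
    h.not_meet (by simp [sPrimeSide]) (by simp [sPrimeEdge]) (by simp [sPrimeEdge])
  have n13 : ¬ Meet (D .x0) (D (.s ⟨1, by omega⟩)) :=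
    h.not_meet (by simp [sPrimeSide]) (by simp [sPrimeEdge]) (by simp [sPrimeEdge])
  have n21 : ¬ Meet (D .xPrime) (D .y0) :=
    h.not_meet (by simp [sPrimeSide]) (by simp [sPrimeEdge]) (by simp [sPrimeEdge])
  have n23 : ¬ Meet (D .xPrime) (D (.s ⟨1, by omega⟩)) :=
    h.not_meet (by simp [sPrimeSide]) (by simp [sPrimeEdge]) (by simp [sPrimeEdge])
  have n31 : ¬ Meet (D (.s ⟨2, by omega⟩)) (D .y0) :=
    h.not_meet (by simp [sPrimeSide]) (by simp [sPrimeEdge]) (by simp [sPrimeEdge])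
  have n32 : ¬ Meet (D (.s ⟨2, by omega⟩)) (D .yPrime) :=
    h.not_meet (by simp [sPrimeSide]) (by simp [sPrimeEdge]) (by simp [sPrimeEdge])
  have t1 : Meet (D (.s 0)) (D (.t 0)) := h.meet (by simp [sPrimeEdge])
  have t2 : Meet (D (.t ⟨1, by omega⟩)) (D (.s ⟨1, by omega⟩)) :=
    (h.meet (by simp [sPrimeEdge])).symm
  have z1 : Meet (D .xOne'') (D (.s ⟨1, by omega⟩)) := h.meet (by simp [sPrimeEdge])
  have z2 : Meet (D .xOne'') (D (.t 0)) := h.meet (by simp [sPrimeEdge])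
  have z3 : ¬ Meet (D .xOne'') (D .y0) :=
    h.not_meet (by simp [sPrimeSide]) (by simp [sPrimeEdge]) (by simp [sPrimeEdge])
  have z4 : ¬ Meet (D .xOne'') (D .yPrime) :=
    h.not_meet (by simp [sPrimeSide]) (by simp [sPrimeEdge]) (by simp [sPrimeEdge])
  have t3 : ¬ Meet (D (.t ⟨1, by omega⟩)) (D .y0) :=
    h.not_meet (by simp [sPrimeSide]) (by simp [sPrimeEdge]) (by simp [sPrimeEdge])
  have t4 : ¬ Meet (D (.t ⟨1, by omega⟩)) (D .yPrime) :=
    h.not_meet (by simp [sPrimeSide]) (by simp [sPrimeEdge]) (by simp [sPrimeEdge])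
  have t5 : ¬ Meet (D (.t ⟨1, by omega⟩)) (D (.t 0)) :=
    h.not_meet (by simp [sPrimeSide]) (by simp [sPrimeEdge]) (by simp [sPrimeEdge])
  have t6 : ¬ Meet (D .xPrime) (D (.t 0)) :=
    h.not_meet (by simp [sPrimeSide]) (by simp [sPrimeEdge]) (by simp [sPrimeEdge])
  have t7 : ¬ Meet (D .x0) (D (.t 0)) :=
    h.not_meet (by simp [sPrimeSide]) (by simp [sPrimeEdge]) (by simp [sPrimeEdge])
  -- Applied to x₁'' and x₁' when y₁ is in the middle: both are then the interior of `x`.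
  have twin : ∀ p q : UnitData, p.a = q.a → ¬ p.l → ¬ p.r → Meet p (D (.t 0)) →
      Meet q (D (.t 0)) := by
    intro p q e hl hr hm
    rcases hm with hm | hm | hm
    · left
      rwa [← e]
    · exact absurd hm.2.1 hr
    · exact absurd hm.2.2 hl
  rcases le_total (D .y0).a (D .yPrime).a with o1 | o1 <;>
    rcases le_total (D .yPrime).a (D (.s ⟨1, by omega⟩)).a with o2 | o2 <;>
    rcases le_total (D .y0).a (D (.s ⟨1, by omega⟩)).a with o3 | o3
  · obtain ⟨c1, c2, c3, c4, c5, c6, c7, c8, c9, c10, c11⟩ :=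
      claw_middle a1 a2 a3 b1 b2 b3 n12 n13 n21 n23 n31 n32 o1 o2
    obtain ⟨d1, d2⟩ := touch_of_common_neighbor c1 c5 c2 c7 t1 t6 z1 z2 z3
    exact Or.inr (Or.inl ⟨c3, c4, c1, c5, c7, c8, c9, c10, c11, c2, c6, d1, d2⟩)
  -- The order relations are cyclic, so the three left endpoints coincide, whereas the outer two
  -- must differ by 2.
  · obtain ⟨c1, c2, c3, c4, c5, c6, c7, c8, c9, c10, c11⟩ :=
      claw_middle a1 a2 a3 b1 b2 b3 n12 n13 n21 n23 n31 n32 o1 o2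
    linarith
  · obtain ⟨c1, c2, c3, c4, c5, c6, c7, c8, c9, c10, c11⟩ :=
      claw_middle a1 a3 a2 b1 b3 b2 n13 n12 n31 n32 n21 n23 o3 o2
    obtain ⟨e1, e2, e3⟩ := interior_of_not_meet c1 c2 c5 c6 c10 c11 t2 t3 t4
    obtain ⟨f1, f2, f3⟩ := interior_of_not_meet c1 c2 c5 c6 c10 c11 z1 z3 z4
    exact absurd (twin _ _ (f1.trans e1.symm) f2 f3 z2) t5
  · exact Or.inl
      (claw_middle a3 a1 a2 b3 b1 b2 n31 n32 n13 n12 n23 n21 o3 o1).1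
  · obtain ⟨c1, c2, c3, c4, c5, c6, c7, c8, c9, c10, c11⟩ :=
      claw_middle a2 a1 a3 b2 b1 b3 n21 n23 n12 n13 n32 n31 o1 o3
    obtain ⟨d1, d2⟩ := touch_of_common_neighbor c1 c5 c2 c7 t1 t7 z1 z2 z4
    exact Or.inr (Or.inr ⟨c3, c4, c1, c5, c7, c8, c9, c10, c11, c2, c6, d1, d2⟩)
  · obtain ⟨c1, c2, c3, c4, c5, c6, c7, c8, c9, c10, c11⟩ :=
      claw_middle a2 a3 a1 b2 b3 b1 n23 n21 n32 n31 n12 n13 o2 o3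
    obtain ⟨e1, e2, e3⟩ := interior_of_not_meet c1 c2 c5 c6 c10 c11 t2 t4 t3
    obtain ⟨f1, f2, f3⟩ := interior_of_not_meet c1 c2 c5 c6 c10 c11 z1 z4 z3
    exact absurd (twin _ _ (f1.trans e1.symm) f2 f3 z2) t5
  · obtain ⟨c1, c2, c3, c4, c5, c6, c7, c8, c9, c10, c11⟩ :=
      claw_middle a2 a1 a3 b2 b1 b3 n21 n23 n12 n13 n32 n31 o1 o3
    linarith
  · exact Or.inl
      (claw_middle a3 a2 a1 b3 b2 b1 n32 n31 n23 n21 n13 n12 o2 o1).1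

/-- In a representation of `S'ᵢ` in which `y₁` and `y₁'` touch `x` on the right, the intervals of
the path continue to the right by unit steps. -/
theorem chain (h : IsSPrimeData i D) (hi : 1 ≤ i)
    (hs : (D (.s ⟨1, by omega⟩)).a = (D (.s 0)).a + 1) (hsl : (D (.s ⟨1, by omega⟩)).l)
    (ht : (D (.t 0)).a = (D (.s 0)).a + 1) (htl : (D (.t 0)).l) (j : ℕ) (hj : j ≤ i) :
    ((D (.s ⟨j + 1, by omega⟩)).a = (D (.s 0)).a + (j + 1) ∧ (D (.s ⟨j + 1, by omega⟩)).l ∧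
      (D (.t ⟨j, by omega⟩)).a = (D (.s 0)).a + (j + 1) ∧ (D (.t ⟨j, by omega⟩)).l) ∧
    (j < i → (D (.s ⟨j + 1, by omega⟩)).r ∧ ¬ (D (.t ⟨j, by omega⟩)).r) := by
  have step : ∀ (j : ℕ) (hj : j < i),
      ((D (.s ⟨j + 1, by omega⟩)).a = (D (.s 0)).a + (j + 1) ∧ (D (.s ⟨j + 1, by omega⟩)).l ∧
      (D (.t ⟨j, by omega⟩)).a = (D (.s 0)).a + (j + 1) ∧ (D (.t ⟨j, by omega⟩)).l) →
      ((D (.s ⟨j + 1, by omega⟩)).r ∧ ¬ (D (.t ⟨j, by omega⟩)).r) ∧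
      ((D (.s ⟨j + 2, by omega⟩)).a = (D (.s 0)).a + (j + 2) ∧ (D (.s ⟨j + 2, by omega⟩)).l ∧
      (D (.t ⟨j + 1, by omega⟩)).a = (D (.s 0)).a + (j + 2) ∧ (D (.t ⟨j + 1, by omega⟩)).l) := by
    rintro j hj ⟨h1, h2, h3, h4⟩
    have m1 : Meet (D (.s ⟨j + 1, by omega⟩)) (D (.s ⟨j + 2, by omega⟩)) :=
      h.meet (by simp [sPrimeEdge])
    have m2 : Meet (D (.s ⟨j + 1, by omega⟩)) (D (.t ⟨j + 1, by omega⟩)) :=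
      h.meet (by simp [sPrimeEdge])
    have n1 : ¬ Meet (D (.t ⟨j, by omega⟩)) (D (.s ⟨j + 2, by omega⟩)) :=
      h.not_meet (by simp [sPrimeSide]; omega) (by simp [sPrimeEdge]) (by simp [sPrimeEdge])
    have n2 : ¬ Meet (D (.t ⟨j, by omega⟩)) (D (.t ⟨j + 1, by omega⟩)) :=
      h.not_meet (by simp [sPrimeSide]; omega) (by simp [sPrimeEdge]) (by simp [sPrimeEdge])
    -- The twins `s (j + 1)` and `t j` agree on the left, so any neighbour of the first alone sits
    -- one unit to the right.
    obtain ⟨r1, r2, r3, r4⟩ := right_of_private (h1.trans h3.symm) h2 h4 m1 n1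
    obtain ⟨-, -, r5, r6⟩ := right_of_private (h1.trans h3.symm) h2 h4 m2 n2
    exact ⟨⟨r1, r2⟩, by linarith, r4, by linarith, r6⟩
  have base : ∀ (j : ℕ) (hj : j ≤ i),
      (D (.s ⟨j + 1, by omega⟩)).a = (D (.s 0)).a + (j + 1) ∧ (D (.s ⟨j + 1, by omega⟩)).l ∧
      (D (.t ⟨j, by omega⟩)).a = (D (.s 0)).a + (j + 1) ∧ (D (.t ⟨j, by omega⟩)).l := by
    intro j
    induction j with
    | zero => exact fun _ => ⟨by simpa using hs, hsl, by simpa using ht, htl⟩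
    | succ j ih =>
      intro hj
      have := (step j (by omega) (ih (by omega))).2
      refine ⟨?_, this.2.1, ?_, this.2.2.2⟩
      · rw [this.1]; push_cast; ring
      · rw [this.2.2.1]; push_cast; ring
  exact ⟨base j hj, fun hj' => (step j hj' (base j hj)).1⟩

/-- In every representation of `S'ᵢ`, the intervals of `v'` and `v''` have the same endpoints, and
they share one of them. -/
theorem twins (h : IsSPrimeData i D) (hi : 1 ≤ i) :
    (D (.s (Fin.last (i + 1)))).a = (D (.t (Fin.last i))).a ∧
    ((D (.s (Fin.last (i + 1)))).l ∧ (D (.t (Fin.last i))).l ∨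
      (D (.s (Fin.last (i + 1)))).r ∧ (D (.t (Fin.last i))).r) := by
  have key : ∀ {D : SPrimeVertex i → UnitData}, IsSPrimeData i D →
      (D (.s ⟨1, by omega⟩)).a = (D (.s 0)).a - 1 ∨
      (D (.s (Fin.last (i + 1)))).a = (D (.t (Fin.last i))).a ∧
      (D (.s (Fin.last (i + 1)))).l ∧ (D (.t (Fin.last i))).l := by
    intro D h
    rcases h.legs hi with e | e | e
    · exact Or.inl e
    all_goals
      obtain ⟨⟨h1, h2, h3, h4⟩, -⟩ := h.chain hi e.sa e.sl e.ta e.tl i le_rfl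
      exact Or.inr ⟨h1.trans h3.symm, h2, h4⟩
  rcases key h with e | e
  -- y₁ cannot be on the left of `x` both in the model and in its mirror image.
  · rcases key h.reflect with e' | e'
    · simp only [UnitData.reflect] at e'
      linarith
    · exact ⟨neg_injective e'.1, Or.inr e'.2⟩
  · exact ⟨e.1, Or.inl e.2⟩

end IsSPrimeData

/-! ### Normalized representations and moves between them -/

/-- The free parameters of a normalized representation of `S'ᵢ`: whether the left endpoint of `y₀`
and the right endpoints of `v'` and `v''` are included, and the intervals `w`, `q`, `z` of `x₀`,
`y'` and `x₁''`. -/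
structure SPrimeConfig where
  yl : Prop
  sr : Prop
  tr : Prop
  w : UnitData
  q : UnitData
  z : UnitData

namespace SPrimeConfig

/-- The intervals of a normalized representation. -/
def data (i : ℕ) (c : SPrimeConfig) : SPrimeVertex i → UnitData
  | .x0 => c.w
  | .y0 => ⟨-1, c.yl, True⟩
  | .xPrime => ⟨0, False, False⟩
  | .yPrime => c.q
  | .xOne'' => c.z
  | .s j => ⟨(j : ℕ), True, (j : ℕ) ≤ i ∨ c.sr⟩
  | .t k => ⟨(k : ℕ) + 1, True, (k : ℕ) = i ∧ c.tr⟩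

/-- The conditions on the parameters of a normalized representation. -/
structure Valid (c : SPrimeConfig) : Prop where
  w_ge : -2 ≤ c.w.a
  w_eq : c.w.a = -2 → c.w.r ∧ c.yl
  wq : c.w.a + 1 ≤ c.q.a
  wq_eq : c.w.a + 1 = c.q.a → ¬ (c.w.r ∧ c.q.l)
  q_gt : -1 < c.q.a
  q_lt : c.q.a < 1
  qz : c.q.a + 1 ≤ c.z.a
  qz_eq : c.q.a + 1 = c.z.a → ¬ (c.q.r ∧ c.z.l)
  z_lt : c.z.a < 2

theorem Valid.isSPrimeData {c : SPrimeConfig} (h : c.Valid) {i : ℕ} (hi : 1 ≤ i) :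
    IsSPrimeData i (c.data i) := by
  obtain ⟨yl, sr, tr, ⟨w, wl, wr⟩, ⟨q, ql, qr⟩, ⟨z, zl, zr⟩⟩ := c
  obtain ⟨h1, h2, h3, h4, h5, h6, h7, h8, h9⟩ := h
  simp only at h1 h2 h3 h4 h5 h6 h7 h8 h9
  have key : ∀ u v, sPrimeSide i u = true → sPrimeSide i v = false →
      (sPrimeEdge i u v ∨ sPrimeEdge i v u ↔
        (data i ⟨yl, sr, tr, ⟨w, wl, wr⟩, ⟨q, ql, qr⟩, ⟨z, zl, zr⟩⟩ u).Meet
          (data i ⟨yl, sr, tr, ⟨w, wl, wr⟩, ⟨q, ql, qr⟩, ⟨z, zl, zr⟩⟩ v)) := by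
    -- Among the vertices of one parity only the first can come near x₀, y₀, x', y' or x₁''; a crude
    -- bound handles all others.
    have even : ∀ j : ℕ, j % 2 = 0 → j = 0 ∧ (j : ℝ) = 0 ∨ 2 ≤ j ∧ (2 : ℝ) ≤ j := by
      intro j hj
      rcases Nat.eq_zero_or_pos j with rfl | h
      · simp
      · have : 2 ≤ j := by omega
        exact Or.inr ⟨this, by exact_mod_cast this⟩
    have odd : ∀ j : ℕ, j % 2 = 1 → j = 1 ∧ (j : ℝ) = 1 ∨ 3 ≤ j ∧ (3 : ℝ) ≤ j := by
      intro j hj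
      by_cases h : j = 1
      · simp [h]
      · have : 3 ≤ j := by omega
        exact Or.inr ⟨this, by exact_mod_cast this⟩
    rintro (_ | _ | _ | _ | _ | ⟨j, hj⟩ | ⟨j, hj⟩) (_ | _ | _ | _ | _ | ⟨k, hk⟩ | ⟨k, hk⟩) hu hv <;>
      simp only [sPrimeSide, reduceCtorEq, decide_eq_true_eq, decide_eq_false_iff_not] at hu hv <;>
      simp only [sPrimeEdge, data, Meet, false_or, or_false, true_iff, false_iff,
        and_true, true_and, false_and, and_false]
    case s.s | s.t | t.s | t.t => norm_cast; omega
    case x0.yPrime | xPrime.y0 | xPrime.yPrime | xOne''.y0 | xOne''.yPrime => grind -ring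
    case x0.s | xPrime.s | xOne''.s => have := odd k (by omega); grind -ring
    case x0.t | xPrime.t | xOne''.t => have := even k (by omega); grind -ring
    case s.y0 | s.yPrime => have := even j (by omega); grind -ring
    case t.y0 | t.yPrime => have := odd j (by omega); grind -ring
    all_goals grind -ring
  intro u v huv
  cases hu : sPrimeSide i u <;> cases hv : sPrimeSide i v
  · exact absurd (hu.trans hv.symm) huv
  · rw [or_comm, key v u hv hu]
    exact ⟨Meet.symm, Meet.symm⟩
  · exact key u v hu hv
  · exact absurd (hu.trans hv.symm) huv

/-- A representation with `x = [0, 1]` in which `y₀` is on the left and `y'` in the middle is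
normalized. -/
theorem exists_of_legs {i : ℕ} (hi : 1 ≤ i) {D : SPrimeVertex i → UnitData}
    (h : IsSPrimeData i D) (h0 : (D (.s 0)).a = 0)
    (e : IsSPrimeData.Legs (D (.s 0)) (D .y0) (D .yPrime) (D .xPrime) (D (.s ⟨1, by omega⟩))
      (D (.t 0))) : ∃ c : SPrimeConfig, c.Valid ∧ c.data i = D := by
  have ch := h.chain hi e.sa e.sl e.ta e.tl
  obtain ⟨xl, xr, ya, yr, Pa, Pl, Pr, m1, m2, sa, sl, ta, tl⟩ := e
  have a1 : Meet (D .x0) (D .y0) := h.meet (by simp [sPrimeEdge])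
  have n1 : ¬ Meet (D .x0) (D .yPrime) :=
    h.not_meet (by simp [sPrimeSide]) (by simp [sPrimeEdge]) (by simp [sPrimeEdge])
  have z2 : Meet (D .xOne'') (D (.t 0)) := h.meet (by simp [sPrimeEdge])
  have z4 : ¬ Meet (D .xOne'') (D .yPrime) :=
    h.not_meet (by simp [sPrimeSide]) (by simp [sPrimeEdge]) (by simp [sPrimeEdge])
  have n2 : ¬ Meet (D .x0) (D (.t 0)) :=
    h.not_meet (by simp [sPrimeSide]) (by simp [sPrimeEdge]) (by simp [sPrimeEdge])
  have z3 : ¬ Meet (D .xOne'') (D .y0) :=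
    h.not_meet (by simp [sPrimeSide]) (by simp [sPrimeEdge]) (by simp [sPrimeEdge])
  have tr := ((ch 0 (by omega)).2 (by omega)).2
  simp only [Fin.zero_eta] at tr
  simp only [h0] at ch ya Pa m1 m2 sa ta
  refine ⟨⟨(D .y0).l, (D (.s (Fin.last (i + 1)))).r, (D (.t (Fin.last i))).r, D .x0, D .yPrime,
    D .xOne''⟩, ?_, ?_⟩
  · have wa := a1.near
    have za := z2.near
    have w1 : (D .x0).a + 1 ≤ (D .yPrime).a := by
      rcases far_of_not_meet n1 with h | h <;> rcases far_of_not_meet n2 with h' | h' <;> linarith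
    have q1 : (D .yPrime).a + 1 ≤ (D .xOne'').a := by
      rcases far_of_not_meet z4 with h | h <;> rcases far_of_not_meet z3 with h' | h' <;> linarith
    refine ⟨by linarith, fun w2 => ?_, w1, fun w2 => ?_, by simpa using m1, by simpa using m2,
      q1, fun w2 => ?_, ?_⟩
    · exact (meet_iff_touch (by linarith)).1 a1
    · exact fun w3 => n1 ((meet_iff_touch w2.symm).2 w3)
    · exact fun w3 => z4 ((meet_iff_touch w2.symm).2 w3).symm
    -- At left endpoint 2, x₁'' could meet y₁' only at its right end, which y₁' omits.
    · refine lt_of_le_of_ne (by linarith) fun w2 => tr ?_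
      exact ((meet_iff_touch (by linarith)).1 z2.symm).1
  · have ext : ∀ {p q : UnitData}, p.a = q.a → (p.l ↔ q.l) → (p.r ↔ q.r) → p = q := by
      rintro ⟨a, l, r⟩ ⟨a', l', r'⟩ h1 h2 h3
      rw [UnitData.mk.injEq]
      exact ⟨h1, propext h2, propext h3⟩
    funext v
    rcases v with _ | _ | _ | _ | _ | ⟨j, hj⟩ | ⟨k, hk⟩
    · rfl
    · exact ext (by simp [data, ya]) Iff.rfl (by simp [data, yr])
    · exact ext (by simp [data, Pa]) (by simp [data, Pl]) (by simp [data, Pr])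
    · rfl
    · rfl
    · rcases j with _ | j
      · exact ext (by simp [data, h0]) (by simp [data, xl]) (by simp [data, xr])
      · obtain ⟨⟨c1, c2, -, -⟩, c3⟩ := ch j (by omega)
        refine ext (by simp [data, c1]) (by simp [data, c2]) ?_
        rcases (show j ≤ i by omega).lt_or_eq with hj' | rfl
        · simp [data, Nat.succ_le_of_lt hj', (c3 hj').1]
        · simp [data, Fin.last]
    · obtain ⟨⟨-, -, c1, c2⟩, c3⟩ := ch k (by omega)
      refine ext (by simp [data, c1]) (by simp [data, c2]) ?_
      rcases (show k ≤ i by omega).lt_or_eq with hk' | rfl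
      · simp [data, hk'.ne, (c3 hk').2]
      · simp [data, Fin.last]

/-- The representation given by a configuration. -/
def rep (i : ℕ) (c : SPrimeConfig) (v : SPrimeVertex i) : Set ℝ := (c.data i v).toSet

theorem Valid.isMixedUnitRep {c : SPrimeConfig} (h : c.Valid) {i : ℕ} (hi : 1 ≤ i) :
    IsMixedUnitRep (SPrime i) (c.rep i) :=
  (isMixedUnitRep_sPrime_iff _).2 (h.isSPrimeData hi)

/-- Two valid configurations that differ in the position or in the type of one interval arise from
each other by a trivial modification. -/
theorem Valid.trivialModification {c c' : SPrimeConfig} (h : c.Valid) (h' : c'.Valid) {i : ℕ}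
    (hi : 1 ≤ i) (v : SPrimeVertex i) (hv : ∀ u, u ≠ v → c.data i u = c'.data i u)
    (e : (c.data i v).a = (c'.data i v).a ∨
      (c.data i v).l = (c'.data i v).l ∧ (c.data i v).r = (c'.data i v).r) :
    TrivialModification (SPrime i) (c.rep i) (c'.rep i) := by
  classical
  refine Relation.ReflTransGen.single ⟨h.isMixedUnitRep hi, h'.isMixedUnitRep hi, ?_⟩
  have upd : ∀ S : Set ℝ, (c'.data i v).toSet = S →
      Function.update (c.rep i) v S = c'.rep i := by
    intro S hS
    funext u
    by_cases hu : u = v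
    · subst hu
      rw [Function.update_self, ← hS]
      rfl
    · rw [Function.update_of_ne hu]
      exact congrArg UnitData.toSet (hv u hu)
  rcases e with e | ⟨e1, e2⟩
  · have hm := (c'.data i v).toSet_mem
    rw [← e] at hm
    rw [← upd _ rfl]
    convert ElementaryChange.retype (B := SPrime i) (c.rep i) v _ _ (c.data i v).toSet_mem hm
  · rw [← upd ((fun r => r + ((c'.data i v).a - (c.data i v).a)) '' c.rep i v)]
    · convert ElementaryChange.shift (B := SPrime i) (c.rep i) v _
    · rw [rep, image_add, e1, e2]
      congr 1
      ring_nf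

/-- The configuration of the standard representation, with `x₀` at `[-2, -1]` or `(-2, -1]`. -/
def std (l : Prop) : SPrimeConfig :=
  ⟨True, True, False, ⟨-2, l, True⟩, ⟨0, False, False⟩, ⟨1, False, False⟩⟩

theorem std_valid (l : Prop) : (std l).Valid := by
  constructor <;> simp [std]

theorem Valid.trivialModification_std {c : SPrimeConfig} (h : c.Valid) {i : ℕ} (hi : 1 ≤ i)
    (l : Prop) : TrivialModification (SPrime i) (c.rep i) ((std l).rep i) := by
  obtain ⟨yl, sr, tr, ⟨w, wl, wr⟩, ⟨q, ql, qr⟩, ⟨z, zl, zr⟩⟩ := c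
  have hl : ∀ {c c' : SPrimeConfig}, c.Valid → c'.Valid → c.w = c'.w → c.q = c'.q → c.z = c'.z →
      c.sr = c'.sr → c.tr = c'.tr → TrivialModification (SPrime i) (c.rep i) (c'.rep i) := by
    rintro ⟨⟩ ⟨⟩ h h' rfl rfl rfl rfl rfl
    refine h.trivialModification h' hi .y0 ?_ (Or.inl rfl)
    rintro (_ | _ | _ | _ | _ | j | k) hu <;> first | rfl | exact absurd rfl hu
  have hs : ∀ {c c' : SPrimeConfig}, c.Valid → c'.Valid → c.w = c'.w → c.q = c'.q → c.z = c'.z →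
      c.yl = c'.yl → c.tr = c'.tr → TrivialModification (SPrime i) (c.rep i) (c'.rep i) := by
    rintro ⟨⟩ ⟨⟩ h h' rfl rfl rfl rfl rfl
    refine h.trivialModification h' hi (.s (Fin.last (i + 1))) ?_ (Or.inl rfl)
    rintro (_ | _ | _ | _ | _ | ⟨j, hj⟩ | k) hu <;> try rfl
    have : j ≤ i := by
      by_contra hj'
      exact hu (congrArg _ (Fin.ext (by simp; omega)))
    simp [data, this]
  have ht : ∀ {c c' : SPrimeConfig}, c.Valid → c'.Valid → c.w = c'.w → c.q = c'.q → c.z = c'.z →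
      c.yl = c'.yl → c.sr = c'.sr → TrivialModification (SPrime i) (c.rep i) (c'.rep i) := by
    rintro ⟨⟩ ⟨⟩ h h' rfl rfl rfl rfl rfl
    refine h.trivialModification h' hi (.t (Fin.last i)) ?_ (Or.inl rfl)
    rintro (_ | _ | _ | _ | _ | j | ⟨k, hk⟩) hu <;> try rfl
    have : k ≠ i := by
      rintro rfl
      exact hu rfl
    simp [data, this]
  have hw : ∀ {c c' : SPrimeConfig}, c.Valid → c'.Valid → c.q = c'.q → c.z = c'.z →
      c.yl = c'.yl → c.sr = c'.sr → c.tr = c'.tr →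
      (c.w.a = c'.w.a ∨ c.w.l = c'.w.l ∧ c.w.r = c'.w.r) →
      TrivialModification (SPrime i) (c.rep i) (c'.rep i) := by
    rintro ⟨⟩ ⟨⟩ h h' rfl rfl rfl rfl rfl e
    refine h.trivialModification h' hi .x0 ?_ e
    rintro (_ | _ | _ | _ | _ | j | k) hu <;> first | rfl | exact absurd rfl hu
  have hq : ∀ {c c' : SPrimeConfig}, c.Valid → c'.Valid → c.w = c'.w → c.z = c'.z →
      c.yl = c'.yl → c.sr = c'.sr → c.tr = c'.tr →
      (c.q.a = c'.q.a ∨ c.q.l = c'.q.l ∧ c.q.r = c'.q.r) →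
      TrivialModification (SPrime i) (c.rep i) (c'.rep i) := by
    rintro ⟨⟩ ⟨⟩ h h' rfl rfl rfl rfl rfl e
    refine h.trivialModification h' hi .yPrime ?_ e
    rintro (_ | _ | _ | _ | _ | j | k) hu <;> first | rfl | exact absurd rfl hu
  have hz : ∀ {c c' : SPrimeConfig}, c.Valid → c'.Valid → c.w = c'.w → c.q = c'.q →
      c.yl = c'.yl → c.sr = c'.sr → c.tr = c'.tr →
      (c.z.a = c'.z.a ∨ c.z.l = c'.z.l ∧ c.z.r = c'.z.r) →
      TrivialModification (SPrime i) (c.rep i) (c'.rep i) := by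
    rintro ⟨⟩ ⟨⟩ h h' rfl rfl rfl rfl rfl e
    refine h.trivialModification h' hi .xOne'' ?_ e
    rintro (_ | _ | _ | _ | _ | j | k) hu <;> first | rfl | exact absurd rfl hu
  -- `z'` gives slack: `z < z'` lets y' move right, `1 < z'` later lets y' go to 0, and `z' < 2`
  -- keeps contact with y₁'.
  obtain ⟨z', hz1, hz2, hz3⟩ : ∃ z', 1 < z' ∧ z < z' ∧ z' < 2 :=
    ⟨(max 1 z + 2) / 2, by linarith [le_max_left 1 z], by linarith [le_max_right 1 z, h.z_lt],
      by linarith [max_lt (show (1 : ℝ) < 2 by norm_num) h.z_lt]⟩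
  obtain ⟨h1, h2, h3, h4, h5, h6, h7, h8, h9⟩ := id h
  simp only at h1 h2 h3 h4 h5 h6 h7 h8 h9
  obtain ⟨q', hq1, hq2⟩ : ∃ q', q < q' ∧ q' + 1 < z' :=
    ⟨(q + (z' - 1)) / 2, by linarith, by linarith⟩
  -- After the three end types, x₁'' and then y' are moved right and opened. Now x₀ is strictly left
  -- of y', so its right end can be included; this and `yl` let it go to -2. Finally y' returns to 0
  -- and x₁'' to 1.
  have k1 : Valid ⟨True, sr, tr, ⟨w, wl, wr⟩, ⟨q, ql, qr⟩, ⟨z, zl, zr⟩⟩ := by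
    constructor <;> simp only <;> grind
  have k2 : Valid ⟨True, True, tr, ⟨w, wl, wr⟩, ⟨q, ql, qr⟩, ⟨z, zl, zr⟩⟩ := by
    constructor <;> simp only <;> grind
  have k3 : Valid ⟨True, True, False, ⟨w, wl, wr⟩, ⟨q, ql, qr⟩, ⟨z, zl, zr⟩⟩ := by
    constructor <;> simp only <;> grind
  have k4 : Valid ⟨True, True, False, ⟨w, wl, wr⟩, ⟨q, ql, qr⟩, ⟨z', zl, zr⟩⟩ := by
    constructor <;> simp only <;> grind
  have k5 : Valid ⟨True, True, False, ⟨w, wl, wr⟩, ⟨q, ql, qr⟩, ⟨z', False, False⟩⟩ := by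
    constructor <;> simp only <;> grind
  have k6 : Valid ⟨True, True, False, ⟨w, wl, wr⟩, ⟨q', ql, qr⟩, ⟨z', False, False⟩⟩ := by
    constructor <;> simp only <;> grind
  have k7 : Valid ⟨True, True, False, ⟨w, wl, wr⟩, ⟨q', False, False⟩, ⟨z', False, False⟩⟩ := by
    constructor <;> simp only <;> grind
  have k8 : Valid ⟨True, True, False, ⟨w, l, True⟩, ⟨q', False, False⟩, ⟨z', False, False⟩⟩ := by
    constructor <;> simp only <;> grind
  have k9 : Valid ⟨True, True, False, ⟨-2, l, True⟩, ⟨q', False, False⟩, ⟨z', False, False⟩⟩ := by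
    constructor <;> simp only <;> grind
  have k10 : Valid ⟨True, True, False, ⟨-2, l, True⟩, ⟨0, False, False⟩, ⟨z', False, False⟩⟩ := by
    constructor <;> simp only <;> grind
  refine .trans (hl h k1 rfl rfl rfl rfl rfl) ?_
  refine .trans (hs k1 k2 rfl rfl rfl rfl rfl) ?_
  refine .trans (ht k2 k3 rfl rfl rfl rfl rfl) ?_
  refine .trans (hz k3 k4 rfl rfl rfl rfl rfl (Or.inr ⟨rfl, rfl⟩)) ?_
  refine .trans (hz k4 k5 rfl rfl rfl rfl rfl (Or.inl rfl)) ?_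
  refine .trans (hq k5 k6 rfl rfl rfl rfl rfl (Or.inr ⟨rfl, rfl⟩)) ?_
  refine .trans (hq k6 k7 rfl rfl rfl rfl rfl (Or.inl rfl)) ?_
  refine .trans (hw k7 k8 rfl rfl rfl rfl rfl (Or.inl rfl)) ?_
  refine .trans (hw k8 k9 rfl rfl rfl rfl rfl (Or.inr ⟨rfl, rfl⟩)) ?_
  refine .trans (hq k9 k10 rfl rfl rfl rfl rfl (Or.inr ⟨rfl, rfl⟩)) ?_
  exact hz k10 (std_valid l) rfl rfl rfl rfl rfl (Or.inr ⟨rfl, rfl⟩)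

end SPrimeConfig

/-! ### Reduction to normalized representations -/

/-- The automorphism of `S'ᵢ` that exchanges the legs `y₀x₀` and `y'x'`. -/
def sPrimeSwap {i : ℕ} : SPrimeVertex i → SPrimeVertex i
  | .x0 => .xPrime
  | .y0 => .yPrime
  | .xPrime => .x0
  | .yPrime => .y0
  | v => v

theorem sPrimeSwap_involutive {i : ℕ} : Function.Involutive (sPrimeSwap (i := i)) := by
  rintro (_ | _ | _ | _ | _ | _ | _) <;> rfl

/-- The automorphism of the graph `S'ᵢ` that exchanges the legs `y₀x₀` and `y'x'`. -/
def sPrimeSwapIso (i : ℕ) : (SPrime i).graph ≃g (SPrime i).graph where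
  toEquiv := sPrimeSwap_involutive.toPerm
  map_rel_iff' := by
    have h : ∀ u v : SPrimeVertex i,
        sPrimeEdge i (sPrimeSwap u) (sPrimeSwap v) ↔ sPrimeEdge i u v := by
      rintro (_ | _ | _ | _ | _ | _ | _) (_ | _ | _ | _ | _ | _ | _) <;> rfl
    intro u v
    simp [SPrime, h, sPrimeSwap_involutive.injective.eq_iff]

theorem side_sPrimeSwapIso (i : ℕ) (v : SPrimeVertex i) :
    (SPrime i).side (sPrimeSwapIso i v) = (SPrime i).side v := by
  rcases v with _ | _ | _ | _ | _ | _ | _ <;> rfl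

theorem std_rep (i : ℕ) (l : Prop) :
    (SPrimeConfig.std l).rep i = sPrimeRep i (toSet ⟨-2, l, True⟩) := by
  funext v
  rcases v with _ | _ | _ | _ | _ | ⟨j, hj⟩ | ⟨k, hk⟩
  · rfl
  · simp [SPrimeConfig.rep, SPrimeConfig.data, SPrimeConfig.std, sPrimeRep, toSet_Icc]
  · simp [SPrimeConfig.rep, SPrimeConfig.data, sPrimeRep, toSet_Ioo]
  · simp [SPrimeConfig.rep, SPrimeConfig.data, SPrimeConfig.std, sPrimeRep, toSet_Ioo]
  · simp [SPrimeConfig.rep, SPrimeConfig.data, SPrimeConfig.std, sPrimeRep, toSet_Ioo]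
    norm_num
  · simp [SPrimeConfig.rep, SPrimeConfig.data, SPrimeConfig.std, sPrimeRep, toSet_Icc]
  · simp [SPrimeConfig.rep, SPrimeConfig.data, SPrimeConfig.std, sPrimeRep, toSet_Ico, add_assoc]
    norm_num

/-- Every representation of `S'ᵢ` can be transformed into the standard one. -/
theorem trivialModification_std {i : ℕ} (hi : 1 ≤ i) (l : Prop) {f : SPrimeVertex i → Set ℝ}
    (hf : IsMixedUnitRep (SPrime i) f) :
    TrivialModification (SPrime i) f ((SPrimeConfig.std l).rep i) := by
  have left : ∀ D : SPrimeVertex i → UnitData, IsSPrimeData i D →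
      IsSPrimeData.Legs (D (.s 0)) (D .y0) (D .yPrime) (D .xPrime) (D (.s ⟨1, by omega⟩))
        (D (.t 0)) →
      TrivialModification (SPrime i) (fun v => (D v).toSet) ((SPrimeConfig.std l).rep i) := by
    intro D hD e
    have hr := (isMixedUnitRep_sPrime_iff D).2 hD
    have hr' := hr.translate (-(D (.s 0)).a)
    refine .head ⟨hr, hr', .translate _ _⟩ ?_
    simp only [image_add] at hr' ⊢
    have hD' := (isMixedUnitRep_sPrime_iff
      (fun v => (⟨(D v).a + -(D (.s 0)).a, (D v).l, (D v).r⟩ : UnitData))).1 hr'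
    obtain ⟨c, hc, hcD⟩ := SPrimeConfig.exists_of_legs hi hD' (by simp) (by
      obtain ⟨h1, h2, h3, h4, h5, h6, h7, h8, h9, h10, h11, h12, h13⟩ := e
      constructor <;> simp only <;> first | assumption | linarith)
    have e' : c.rep i = fun v => toSet ⟨(D v).a + -(D (.s 0)).a, (D v).l, (D v).r⟩ := by
      funext v
      rw [SPrimeConfig.rep, hcD]
    rw [← e']
    exact hc.trivialModification_std hi l
  have both : ∀ D : SPrimeVertex i → UnitData, IsSPrimeData i D →
      (IsSPrimeData.Legs (D (.s 0)) (D .y0) (D .yPrime) (D .xPrime) (D (.s ⟨1, by omega⟩))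
        (D (.t 0)) ∨
      IsSPrimeData.Legs (D (.s 0)) (D .yPrime) (D .y0) (D .x0) (D (.s ⟨1, by omega⟩))
        (D (.t 0))) →
      TrivialModification (SPrime i) (fun v => (D v).toSet) ((SPrimeConfig.std l).rep i) := by
    rintro D hD (e | e)
    · exact left D hD e
    · have hr := (isMixedUnitRep_sPrime_iff D).2 hD
      have hr' := hr.relabel (sPrimeSwapIso i) (side_sPrimeSwapIso i)
      refine .head ⟨hr, hr', .relabel _ _ (side_sPrimeSwapIso i)⟩ ?_
      exact left (fun v => D (sPrimeSwapIso i v)) ((isMixedUnitRep_sPrime_iff _).1 hr') e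
  obtain ⟨D, rfl⟩ := hf.exists_unitData
  have hD := (isMixedUnitRep_sPrime_iff D).1 hf
  rcases hD.legs hi with e | e
  -- The point 1/2 makes the reflection agree with `UnitData.reflect`.
  · have hr := hf.reflect (1 / 2)
    have e' : (fun v => (fun x => 2 * (1 / 2 : ℝ) - x) '' (D v).toSet) =
        fun v => (D v).reflect.toSet := by
      funext v
      rw [image_reflect]
      simp [UnitData.reflect]
    refine .head ⟨hf, hr, .reflect _ _⟩ ?_
    rw [e']
    refine both _ hD.reflect ((hD.reflect.legs hi).resolve_left fun h => ?_)
    simp only [UnitData.reflect] at h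
    linarith
  · exact both D hD e

/-! ### The bipartite claw in S'ᵢ -/

/-- The vertices of the bipartite claw in `S'ᵢ`. -/
def clawVertex (i : ℕ) : Option (Fin 3 × Bool) → SPrimeVertex i
  | none => .s 0
  | some (0, false) => .y0
  | some (0, true) => .x0
  | some (1, false) => .yPrime
  | some (1, true) => .xPrime
  | some (2, false) => .s 1
  | some (2, true) => .s 2

theorem sPrime_induces_bipartiteClaw {i : ℕ} (hi : 1 ≤ i) :
    Nonempty ((SPrime i).graph.induce
      {SPrimeVertex.x0, SPrimeVertex.y0, SPrimeVertex.s 0, SPrimeVertex.yPrime,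
        SPrimeVertex.xPrime, SPrimeVertex.s 1, SPrimeVertex.s 2} ≃g bipartiteClaw) := by
  -- For `i = 0` the numeral `2 : Fin (i + 2)` would wrap around to 0.
  obtain ⟨m, rfl⟩ : ∃ m, i = m + 1 := ⟨i - 1, by omega⟩
  have e2 : 2 % (m + 1 + 2) = 2 := Nat.mod_eq_of_lt (by omega)
  have i1 : (1 : Fin (m + 1 + 2)) ≠ 0 := fun h => by simpa using congrArg Fin.val h
  have i2 : (2 : Fin (m + 1 + 2)) ≠ 0 := fun h => by simpa [e2] using congrArg Fin.val h
  have i3 : (2 : Fin (m + 1 + 2)) ≠ 1 := fun h => by simpa [e2] using congrArg Fin.val h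
  have inj : Function.Injective (clawVertex (m + 1)) := by
    rintro (_ | ⟨k, _ | _⟩) (_ | ⟨k', _ | _⟩) h <;> try fin_cases k
    all_goals try fin_cases k'
    all_goals simp_all [clawVertex, i1.symm, i2.symm, i3.symm]
  have adj : ∀ a b, (SPrime (m + 1)).graph.Adj (clawVertex (m + 1) a) (clawVertex (m + 1) b) ↔
      bipartiteClaw.Adj a b := by
    intro a b
    simp only [SPrime, bipartiteClaw, SimpleGraph.fromRel_adj, inj.ne_iff]
    refine and_congr_right fun _ => ?_
    rcases a with _ | ⟨k, _ | _⟩ <;> rcases b with _ | ⟨k', _ | _⟩ <;> try fin_cases k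
    all_goals try fin_cases k'
    all_goals simp [clawVertex, sPrimeEdge, e2]
  have range : Set.range (clawVertex (m + 1)) =
      {SPrimeVertex.x0, SPrimeVertex.y0, SPrimeVertex.s 0, SPrimeVertex.yPrime,
        SPrimeVertex.xPrime, SPrimeVertex.s 1, SPrimeVertex.s 2} := by
    ext v
    simp only [Set.mem_range, Option.exists, Prod.exists, Fin.exists_fin_succ, Bool.exists_bool,
      clawVertex, Set.mem_insert_iff, Set.mem_singleton_iff, eq_comm (a := v)]
    simp
    tauto
  rw [← range]
  refine ⟨RelIso.symm ⟨Equiv.ofInjective _ inj, fun {a b} => ?_⟩⟩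
  exact adj a b

/-! ### Sᵢ is forbidden -/

/-- In a representation of `S'ᵢ`, the vertices `v'` and `v''` do not both have private
neighbours. -/
theorem IsSPrimeData.no_private_pair {i : ℕ} (hi : 1 ≤ i) {D : SPrimeVertex i → UnitData}
    (h : IsSPrimeData i D) {p q : UnitData}
    (h1 : (D (.s (Fin.last (i + 1)))).Meet p) (h2 : ¬ (D (.t (Fin.last i))).Meet p)
    (h3 : (D (.t (Fin.last i))).Meet q) (h4 : ¬ (D (.s (Fin.last (i + 1)))).Meet q) : False := by
  obtain ⟨e, he⟩ := h.twins hi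
  have := privates_of_left_eq e h1.symm (fun h => h2 h.symm) h3.symm (fun h => h4 h.symm)
  tauto

theorem not_isMixedUnitRep_sBigraph {i : ℕ} (hi : 1 ≤ i) (f : SPrimeVertex i ⊕ Bool → Set ℝ) :
    ¬ IsMixedUnitRep (SBigraph i) f := by
  intro hf
  obtain ⟨D, rfl⟩ := hf.exists_unitData
  rw [isMixedUnitRep_toSet_iff] at hf
  have h : IsSPrimeData i (fun v => D (.inl v)) := by
    intro u v huv
    rw [← hf (.inl u) (.inl v) huv]
    have : u ≠ v := fun e => huv (e ▸ rfl)
    simp [SBigraph, sEdge, this]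
  refine h.no_private_pair hi (p := D (.inr false)) (q := D (.inr true)) ?_ ?_ ?_ ?_
  · rw [← hf _ _ (by simp [SBigraph, sSide, sPrimeSide]; omega)]
    simp [SBigraph, sEdge]
  · rw [← hf _ _ (by simp [SBigraph, sSide, sPrimeSide]; omega)]
    simp [SBigraph, sEdge]
  · rw [← hf _ _ (by simp [SBigraph, sSide, sPrimeSide]; omega)]
    simp [SBigraph, sEdge]
  · rw [← hf _ _ (by simp [SBigraph, sSide, sPrimeSide]; omega)]
    simp [SBigraph, sEdge]

/-- Connectedness matters because an embedding of graphs need not respect partite sets; on a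
connected graph it can at most exchange them. -/
theorem sBigraph_connected (i : ℕ) (v : SPrimeVertex i ⊕ Bool) :
    (SBigraph i).graph.Reachable (.inl (.s 0)) v := by
  have step : ∀ {u v : SPrimeVertex i ⊕ Bool}, (SBigraph i).graph.Reachable (.inl (.s 0)) u →
      sEdge i u v ∨ sEdge i v u → (SBigraph i).graph.Reachable (.inl (.s 0)) v := by
    intro u v hu huv
    refine hu.trans (SimpleGraph.Adj.reachable ⟨?_, huv⟩)
    rintro rfl
    rcases huv with h | h <;> exact sSide_ne i _ _ h rfl
  have hs : ∀ (j : ℕ) (hj : j < i + 2), (SBigraph i).graph.Reachable (.inl (.s 0))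
      (.inl (.s ⟨j, hj⟩)) := by
    intro j
    induction j with
    | zero => exact fun _ => .refl _
    | succ j ih => exact fun hj => step (ih (by omega)) (Or.inl rfl)
  have hy0 : (SBigraph i).graph.Reachable (.inl (.s 0)) (.inl .y0) :=
    step (hs 0 (by omega)) (Or.inr rfl)
  have hy' : (SBigraph i).graph.Reachable (.inl (.s 0)) (.inl .yPrime) :=
    step (hs 0 (by omega)) (Or.inr rfl)
  have ht : ∀ (j : ℕ) (hj : j < i + 1), (SBigraph i).graph.Reachable (.inl (.s 0))
      (.inl (.t ⟨j, hj⟩)) := fun j hj => step (hs j (by omega)) (Or.inl rfl)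
  rcases v with (_ | _ | _ | _ | _ | j | k) | (_ | _)
  · exact step hy0 (Or.inr trivial)
  · exact hy0
  · exact step hy' (Or.inr trivial)
  · exact hy'
  · exact step (hs 1 (by omega)) (Or.inr rfl)
  · exact hs j j.2
  · exact ht k k.2
  · exact step (hs (i + 1) (by omega)) (Or.inl rfl)
  · exact step (ht i (by omega)) (Or.inl rfl)

/-- An embedding of the graph of a connected bigraph into the graph of another one either preserves
the partite sets or exchanges them. -/
theorem Bigraph.side_ne_iff_of_embedding {V W : Type*} {A : Bigraph V} {B : Bigraph W}
    (φ : A.graph ↪g B.graph) {r : V} (hr : ∀ v, A.graph.Reachable r v) (u v : V) :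
    B.side (φ u) ≠ B.side (φ v) ↔ A.side u ≠ A.side v := by
  -- Both sides flip along every edge, so their `xor` is constant along walks from `r`.
  have key : ∀ v, B.side (φ v) = xor (A.side v) (xor (A.side r) (B.side (φ r))) := by
    intro v
    obtain ⟨p⟩ := hr v
    have : ∀ {u v : V} (_ : A.graph.Walk u v), xor (B.side (φ v)) (A.side v) =
        xor (B.side (φ u)) (A.side u) := by
      intro u v p
      induction p with
      | nil => rfl
      | cons h p ih =>
        rw [ih]
        have h1 := A.side_ne _ _ h
        have h2 := B.side_ne _ _ (φ.map_adj_iff.2 h)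
        revert h1 h2
        generalize A.side _ = a
        generalize A.side _ = b
        generalize B.side _ = c
        generalize B.side _ = d
        revert a b c d
        decide
    have := this p
    revert this
    generalize A.side _ = a
    generalize A.side _ = b
    generalize B.side _ = c
    generalize B.side _ = d
    revert a b c d
    decide
  rw [key u, key v]
  simp

theorem sBigraph_forbidden {i : ℕ} (hi : 1 ≤ i) {W : Type*} (B : Bigraph W)
    (hB : IsMixedUnitIntervalBigraph B) : ¬ Nonempty ((SBigraph i).graph ↪g B.graph) := by
  rintro ⟨φ⟩
  obtain ⟨f, hf⟩ := hB
  refine not_isMixedUnitRep_sBigraph hi (fun v => f (φ v)) ⟨fun v => hf.1 _, fun u v huv => ?_⟩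
  rw [← Bigraph.side_ne_iff_of_embedding φ (sBigraph_connected i), ← hf.2 _ _ (φ.injective.ne huv)]
  exact φ.map_adj_iff.symm

theorem lemma9 (i : ℕ) (hi : 1 ≤ i) :
    -- the vertices `x₀, y₀, x, y', x', y₁, x₁` induce the bipartite claw in `S'ᵢ`
    Nonempty ((SPrime i).graph.induce
      {SPrimeVertex.x0, SPrimeVertex.y0, SPrimeVertex.s 0, SPrimeVertex.yPrime,
        SPrimeVertex.xPrime, SPrimeVertex.s 1, SPrimeVertex.s 2} ≃g bipartiteClaw) ∧
    -- the standard representation (with either interval for `x₀`) is a representation of `S'ᵢ`,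
    -- and every representation of `S'ᵢ` arises from it by trivial modifications
    (∀ X₀ : Set ℝ, X₀ = Set.Icc (-2) (-1) ∨ X₀ = Set.Ioc (-2) (-1) →
      IsMixedUnitRep (SPrime i) (sPrimeRep i X₀) ∧
      ∀ f : SPrimeVertex i → Set ℝ, IsMixedUnitRep (SPrime i) f →
        TrivialModification (SPrime i) (sPrimeRep i X₀) f) ∧
    -- no mixed unit interval bigraph has `Sᵢ` as an induced subgraph
    (∀ {W : Type*} (B : Bigraph W), IsMixedUnitIntervalBigraph B →
      ¬ Nonempty ((SBigraph i).graph ↪g B.graph)) := by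
  refine ⟨sPrime_induces_bipartiteClaw hi, fun X₀ hX => ?_, fun B hB => sBigraph_forbidden hi B hB⟩
  obtain ⟨l, rfl⟩ : ∃ l : Prop, X₀ = toSet ⟨-2, l, True⟩ := by
    have e : (-2 : ℝ) + 1 = -1 := by norm_num
    rcases hX with rfl | rfl
    · exact ⟨True, by rw [toSet_Icc, e]⟩
    · exact ⟨False, by rw [toSet_Ioc, e]⟩
  rw [← std_rep]
  exact ⟨(SPrimeConfig.std_valid l).isMixedUnitRep hi,
    fun f hf => (trivialModification_std hi l hf).symm⟩
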